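/- Let $d\ge 5$ and $n\ge 1$ be integers and let $-\frac{1}{d-1}<\rho<1$. Let $\mu=(\mu_1,\dots,\mu_d)^T$ have the Gaussian law $G_0=N_d(0,\Sigma_d(\rho))$ with compound symmetric covariance matrix $\Sigma_d(\rho)=(1-\rho)I_d+\rho\,1_d1_d^T$, where $1_d$ is the vector of ones, and, given $\mu$, let the observations $Y_{ij}\sim N(\mu_j,1)$, $1\le i\le n$, $1\le j\le d$, be independent. Put $\bar Y_j=n^{-1}\sum_{i=1}^n Y_{ij}$ and $\bar Y=d^{-1}\sum_{j=1}^d\bar Y_j$, and consider the estimators of $\mu$ with coordinates $$\hat\mu_{j,\mathrm{HB}}=\bar Y+\Big[1-\frac{d-3}{n\sum_{k=1}^d(\bar Y_k-\bar Y)^2}\Big](\bar Y_j-\bar Y),\qquad \hat\mu_{j,\mathrm{PHB}}=\Big[1-\frac{d-2}{n\sum_{k=1}^d\bar Y_k^2}\Big]\bar Y_j .$$ For an estimator $\hat\mu$ let $R(\hat\mu,\rho)=\int_{\mathbb R^d}E_{Y\mid\mu}\|\hat\mu-\mu\|_2^2\,dG_0(\mu)$ be its integrated squared-error risk. Then both risks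 are finite and $$R(\hat\mu_{\mathrm{HB}},\rho)=\frac dn-\frac{d-3}{n}\,\frac{1}{1+n(1-\rho)},\qquad R(\hat\mu_{\mathrm{PHB}},\rho)=\frac dn-\frac{(d-2)^2}{2n}\int_0^1\frac{u^{\frac{d-2}{2}-1}}{\sqrt{\xi(u;\rho)}}\,du,$$ where $\xi(u;\rho)=\big[1+n\{1+(d-1)\rho\}(1-u)\big]\big[1+n(1-\rho)(1-u)\big]^{d-1}$ for $u\in[0,1]$. -/

import Mathlib

open MeasureTheory ProbabilityTheory
open scoped Matrix

noncomputable section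

namespace NormalMeans

/-- The compound symmetric correlation matrix `(1 - ρ) I_d + ρ 1_d 1_dᵀ`. -/
def compoundSymm (d : ℕ) (ρ : ℝ) : Matrix (Fin d) (Fin d) ℝ :=
  (1 - ρ) • (1 : Matrix (Fin d) (Fin d) ℝ) +
    ρ • Matrix.vecMulVec (fun _ => (1 : ℝ)) (fun _ => (1 : ℝ))

/-- For `-1/(d-1) < ρ < 1` the compound symmetric matrix is positive definite, so that it is the
covariance matrix of a nondegenerate Gaussian law. -/
theorem compoundSymm_posDef {d : ℕ} (hd : 2 ≤ d) {ρ : ℝ} (h₀ : -1 / ((d : ℝ) - 1) < ρ)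
    (h₁ : ρ < 1) : (compoundSymm d ρ).PosDef := by
  have hd' : (0 : ℝ) < (d : ℝ) - 1 := by
    have : (2 : ℝ) ≤ d := by exact_mod_cast hd
    linarith
  have h₂ : 0 < 1 + ((d : ℝ) - 1) * ρ := by
    rw [div_lt_iff₀ hd'] at h₀
    linarith
  refine Matrix.PosDef.of_dotProduct_mulVec_pos ?_ ?_
  · ext i j
    by_cases h : i = j
    · simp [compoundSymm, Matrix.vecMulVec_apply, h]
    · simp [compoundSymm, Matrix.vecMulVec_apply, Matrix.one_apply, h, Ne.symm h]
  · intro x hx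
    have e : star x ⬝ᵥ (compoundSymm d ρ *ᵥ x) =
        (1 - ρ) * ∑ i, x i ^ 2 + ρ * (∑ i, x i) ^ 2 := by
      rw [compoundSymm, Matrix.add_mulVec, Matrix.smul_mulVec, Matrix.smul_mulVec,
        Matrix.one_mulVec, dotProduct_add, dotProduct_smul, dotProduct_smul,
        Matrix.vecMulVec_mulVec, dotProduct_smul]
      simp [dotProduct, sq]
    have hs : 0 < ∑ i, x i ^ 2 := by
      obtain ⟨i, hi⟩ := Function.ne_iff.mp hx
      exact Finset.sum_pos' (fun i _ => sq_nonneg _)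
        ⟨i, Finset.mem_univ i, by have : x i ≠ 0 := hi
                                  positivity⟩
    have hc : (∑ i, x i) ^ 2 ≤ d * ∑ i, x i ^ 2 := by
      simpa using sq_sum_le_card_mul_sum_sq (s := Finset.univ) (f := x)
    rw [e]
    rcases le_or_gt 0 ρ with h | h
    · have : 0 < (1 - ρ) * ∑ i, x i ^ 2 := mul_pos (by linarith) hs
      nlinarith [mul_nonneg h (sq_nonneg (∑ i, x i))]
    · nlinarith [mul_le_mul_of_nonpos_left hc h.le, mul_pos h₂ hs]

/-- The law of the data `Y = (Y i j)`, `i < n`, `j < d`, given the mean vector `μ`: the `Y i j` are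
independent and `Y i j ∼ N(μ j, 1)`. -/
def dataLaw (n : ℕ) {d : ℕ} (μ : EuclideanSpace ℝ (Fin d)) : Measure (Fin n → Fin d → ℝ) :=
  Measure.pi fun _ : Fin n => Measure.pi fun j : Fin d => gaussianReal (μ j) 1

/-- The sample mean of the `j`-th population. -/
def sampleMean {n d : ℕ} (Y : Fin n → Fin d → ℝ) (j : Fin d) : ℝ :=
  (n : ℝ)⁻¹ * ∑ i, Y i j

/-- The grand mean of the data. -/
def grandMean {n d : ℕ} (Y : Fin n → Fin d → ℝ) : ℝ :=
  (d : ℝ)⁻¹ * ∑ j, sampleMean Y j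

/-- The partial-hierarchical Bayes (James-Stein) estimator. -/
def estPHB {n d : ℕ} (Y : Fin n → Fin d → ℝ) : EuclideanSpace ℝ (Fin d) :=
  WithLp.toLp 2 fun j =>
    (1 - ((d : ℝ) - 2) / ((n : ℝ) * ∑ k, sampleMean Y k ^ 2)) * sampleMean Y j

/-- The hierarchical Bayes estimator. -/
def estHB {n d : ℕ} (Y : Fin n → Fin d → ℝ) : EuclideanSpace ℝ (Fin d) :=
  WithLp.toLp 2 fun j =>
    grandMean Y +
      (1 - ((d : ℝ) - 3) / ((n : ℝ) * ∑ k, (sampleMean Y k - grandMean Y) ^ 2)) *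
        (sampleMean Y j - grandMean Y)

/-- The squared `ℓ²` risk `E_{Y ∣ μ} ‖est Y - μ‖²`, as a value in `[0, ∞]`. -/
def risk {n d : ℕ} (est : (Fin n → Fin d → ℝ) → EuclideanSpace ℝ (Fin d))
    (μ : EuclideanSpace ℝ (Fin d)) : ENNReal :=
  ∫⁻ Y, ENNReal.ofReal (‖est Y - μ‖ ^ 2) ∂(dataLaw n μ)

/-- The integrated squared `ℓ²` risk of an estimator when `μ ∼ G`, as a value in `[0, ∞]`. -/
def integratedRisk {n d : ℕ} (est : (Fin n → Fin d → ℝ) → EuclideanSpace ℝ (Fin d))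
    (G : Measure (EuclideanSpace ℝ (Fin d))) : ENNReal :=
  ∫⁻ μ, risk est μ ∂G

/-- The function `ξ(u; ρ)`. -/
def xi (n d : ℕ) (ρ u : ℝ) : ℝ :=
  (1 + (n : ℝ) * (1 + ((d : ℝ) - 1) * ρ) * (1 - u)) *
    (1 + (n : ℝ) * (1 - ρ) * (1 - u)) ^ (d - 1)

end NormalMeans

end

/-!
Let `X` be the vector of sample means, let `V` be the subspace towards whose origin the estimator
shrinks (`ℝ^d` for the partial-hierarchical rule, the orthogonal complement of the diagonal for the
hierarchical one), and let `c = (dim V - 2) / n` be the shrinkage constant. Stein's identity shows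
that, for each fixed `μ`, the risk and `c ^ 2 * E[1 / ‖P_V X‖ ^ 2]` add up to `d / n`.

Under the prior, `X` is centred Gaussian with independent coordinates along the principal axes of
the covariance matrix, and its variance along an axis of prior variance `λ` is `λ + 1 / n`. Writing
`1 / q = ∫ t in (0, ∞), exp (-t q)` and integrating the Gaussian out first turns the inverse moment
into a one-dimensional integral. On the complement of the diagonal all variances agree and this
integral is elementary; on `ℝ^d` the substitution `t = n / 2 * (1 / u - 1)` produces `ξ`.
Working with `[0, ∞]`-valued integrals, finiteness of the risk comes from the same identity.
-/

namespace NormalMeans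

open Finset Set Filter Topology
open scoped NNReal ENNReal RealInnerProductSpace

section GaussianReal

variable {m : ℝ} {v : ℝ≥0}

theorem hasDerivAt_gaussianPDFReal (m : ℝ) (v : ℝ≥0) (x : ℝ) :
    HasDerivAt (gaussianPDFReal m v) (-((x - m) / v) * gaussianPDFReal m v x) x := by
  have hexponent : HasDerivAt (fun x => -(x - m) ^ 2 / (2 * v)) (-((x - m) / v)) x := by
    convert! (((hasDerivAt_id x).sub_const m).pow 2).neg.div_const (2 * (v : ℝ)) using 1
    simp [neg_div, mul_div_mul_left]
  convert! hexponent.exp.const_mul (√(2 * Real.pi * v))⁻¹ using 1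
  rw [gaussianPDFReal]
  ring

theorem integral_sub_mul_gaussianReal {h h' : ℝ → ℝ} (hderiv : ∀ x, HasDerivAt h (h' x) x)
    (hint : Integrable h (gaussianReal m v))
    (hint_mul : Integrable (fun x => (x - m) * h x) (gaussianReal m v))
    (hint_deriv : Integrable h' (gaussianReal m v)) :
    ∫ x, (x - m) * h x ∂gaussianReal m v = v * ∫ x, h' x ∂gaussianReal m v := by
  rcases eq_or_ne v 0 with rfl | hv
  · simp
  have hv' : (v : ℝ) ≠ 0 := by exact_mod_cast hv
  rw [gaussianReal_of_var_ne_zero m hv, gaussianPDF_def] at hint hint_mul hint_deriv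
  simp only [integrable_withDensity_iff_integrable_smul'
    (f := fun x => ENNReal.ofReal (gaussianPDFReal m v x)) (by fun_prop) (by simp),
    ENNReal.toReal_ofReal (gaussianPDFReal_nonneg m v _), smul_eq_mul] at hint hint_mul hint_deriv
  simp only [integral_gaussianReal_eq_integral_smul hv, smul_eq_mul]
  have hzero : ∫ x, (gaussianPDFReal m v x * h' x -
      (v : ℝ)⁻¹ * (gaussianPDFReal m v x * ((x - m) * h x))) = 0 := by
    refine integral_eq_zero_of_hasDerivAt_of_integrable
      (f := fun x => gaussianPDFReal m v x * h x) (fun x => ?_)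
      (hint_deriv.sub (hint_mul.const_mul _)) hint
    convert! (hasDerivAt_gaussianPDFReal m v x).mul (hderiv x) using 1
    ring
  rw [integral_sub hint_deriv (hint_mul.const_mul _), integral_const_mul, sub_eq_zero] at hzero
  rw [hzero, mul_inv_cancel_left₀ hv']

theorem lintegral_exp_neg_mul_sq_gaussianReal (m : ℝ) (v : ℝ≥0) {t : ℝ} (ht : 0 ≤ t) :
    ∫⁻ x, ENNReal.ofReal (Real.exp (-t * x ^ 2)) ∂gaussianReal m v =
      ENNReal.ofReal (Real.exp (-(t / (1 + 2 * t * v)) * m ^ 2)) *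
        ENNReal.ofReal (√(1 + 2 * t * v))⁻¹ := by
  rcases eq_or_ne v 0 with rfl | hv
  · simp
  have : (0 : ℝ) < v := by exact_mod_cast pos_iff_ne_zero.2 hv
  have complete_square (x : ℝ) : gaussianPDFReal m v x • Real.exp (-t * x ^ 2) =
      (√(2 * Real.pi * v))⁻¹ * Real.exp (-(t / (1 + 2 * t * v)) * m ^ 2) *
        Real.exp (-((1 + 2 * t * v) / (2 * v)) * (x - m / (1 + 2 * t * v)) ^ 2) := by
    simp only [gaussianPDFReal, smul_eq_mul, mul_assoc, ← Real.exp_add]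
    congr 2
    field_simp
    ring
  rw [← ENNReal.ofReal_mul (Real.exp_pos _).le, ← ofReal_integral_eq_lintegral_ofReal,
    integral_gaussianReal_eq_integral_smul hv]
  · simp_rw [complete_square]
    rw [integral_const_mul, integral_sub_right_eq_self
      (fun x => Real.exp (-((1 + 2 * t * v) / (2 * v)) * x ^ 2)), integral_gaussian,
      mul_comm (√_)⁻¹, mul_assoc, ← Real.sqrt_inv, ← Real.sqrt_inv, ← Real.sqrt_mul (by positivity)]
    congr 4
    have := Real.pi_pos
    field_simp
  · refine Integrable.of_bound (C := 1) (by fun_prop) (ae_of_all _ fun x => ?_)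
    rw [Real.norm_eq_abs, Real.abs_exp, Real.exp_le_one_iff]
    nlinarith [mul_nonneg ht (sq_nonneg x)]
  · exact ae_of_all _ fun _ => (Real.exp_pos _).le

end GaussianReal

section GaussianPi

variable {ι : Type*}

theorem measurePreserving_update_pi [Fintype ι] [DecidableEq ι] {α : ι → Type*}
    [∀ i, MeasurableSpace (α i)] (μ : ∀ i, Measure (α i)) [∀ i, IsProbabilityMeasure (μ i)]
    (j : ι) : MeasurePreserving (fun p : (∀ i, α i) × α j => Function.update p.1 j p.2)
      ((Measure.pi μ).prod (μ j)) (Measure.pi μ) := by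
  have hmeas : Measurable (fun p : (∀ i, α i) × α j => Function.update p.1 j p.2) := by
    refine measurable_pi_iff.2 fun i => ?_
    rcases eq_or_ne i j with rfl | h
    · simpa only [Function.update_self] using measurable_snd
    · simp only [Function.update_of_ne h]
      fun_prop
  refine ⟨hmeas, (Measure.pi_eq fun s hs => ?_).symm⟩
  have hpreimage : (fun p : (∀ i, α i) × α j => Function.update p.1 j p.2) ⁻¹' Set.univ.pi s =
      Set.univ.pi (Function.update s j Set.univ) ×ˢ s j := by
    ext ⟨x, y⟩
    simp only [Set.mem_preimage, Set.mem_univ_pi, Set.mem_prod,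
      Function.forall_update_iff _ fun i S => x i ∈ S,
      Function.forall_update_iff _ fun i z => z ∈ s i]
    grind
  rw [Measure.map_apply hmeas (MeasurableSet.univ_pi hs), hpreimage, Measure.prod_prod,
    Measure.pi_pi, ← mul_prod_erase univ _ (mem_univ j), ← mul_prod_erase univ _ (mem_univ j),
    Function.update_self, measure_univ, one_mul, mul_comm]
  congr 1
  exact prod_congr rfl fun i hi => by rw [Function.update_of_ne (ne_of_mem_erase hi)]

theorem lintegral_pi_prod [Fintype ι] {α : ι → Type*} [∀ i, MeasurableSpace (α i)]
    (μ : ∀ i, Measure (α i)) [∀ i, IsProbabilityMeasure (μ i)] (s : Finset ι)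
    {f : ∀ i, α i → ℝ≥0∞} (hf : ∀ i, Measurable (f i)) :
    ∫⁻ x, ∏ j ∈ s, f j (x j) ∂Measure.pi μ = ∏ j ∈ s, ∫⁻ x, f j x ∂μ j := by
  have hindep : iIndepFun (fun i (x : ∀ i, α i) => f i (x i)) (Measure.pi μ) :=
    iIndepFun_pi fun i => (hf i).aemeasurable
  rw [lintegral_prod_eq_prod_lintegral_of_indepFun s _ hindep fun i => by fun_prop]
  exact prod_congr rfl fun j _ => (measurePreserving_eval μ j).lintegral_comp (hf j)

/-- The law of a vector with independent Gaussian coordinates of means `m i` and variances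
`v i`. -/
noncomputable abbrev gaussianPi [Fintype ι] (m : ι → ℝ) (v : ι → ℝ≥0) : Measure (ι → ℝ) :=
  Measure.pi fun i => gaussianReal (m i) (v i)

variable [Fintype ι] {m : ι → ℝ} {v : ι → ℝ≥0}

theorem integral_eval_sub_mul_gaussianPi [DecidableEq ι] {j : ι} {F F' : (ι → ℝ) → ℝ}
    (hderiv : ∀ᵐ x ∂gaussianPi m v, ∀ y : ℝ,
      HasDerivAt (fun y => F (Function.update x j y)) (F' (Function.update x j y)) y)
    (hint : Integrable F (gaussianPi m v))
    (hint_mul : Integrable (fun x => (x j - m j) * F x) (gaussianPi m v))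
    (hint_deriv : Integrable F' (gaussianPi m v)) :
    ∫ x, (x j - m j) * F x ∂gaussianPi m v = v j * ∫ x, F' x ∂gaussianPi m v := by
  have hupdate := measurePreserving_update_pi (fun i => gaussianReal (m i) (v i)) j
  have fubini {G : (ι → ℝ) → ℝ} (hG : Integrable G (gaussianPi m v)) : ∫ x, G x ∂gaussianPi m v =
      ∫ x, ∫ y, G (Function.update x j y) ∂gaussianReal (m j) (v j) ∂gaussianPi m v := by
    have hmap := integral_map (f := G) hupdate.aemeasurable (by rw [hupdate.map_eq]; exact hG.1)
    rw [hupdate.map_eq] at hmap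
    exact hmap.trans (integral_prod _ (hupdate.integrable_comp_of_integrable hG))
  rw [fubini hint_mul, fubini hint_deriv, ← integral_const_mul]
  refine integral_congr_ae ?_
  filter_upwards [hderiv, (hupdate.integrable_comp_of_integrable hint).prod_right_ae,
    (hupdate.integrable_comp_of_integrable hint_mul).prod_right_ae,
    (hupdate.integrable_comp_of_integrable hint_deriv).prod_right_ae]
    with x hx hint_x hint_mul_x hint_deriv_x
  simp only [Function.comp_apply, Function.update_self] at hint_mul_x ⊢
  exact integral_sub_mul_gaussianReal hx hint_x hint_mul_x hint_deriv_x

theorem integrable_eval_sub_sq_gaussianPi (m : ι → ℝ) (v : ι → ℝ≥0) (j : ι) :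
    Integrable (fun x => (x j - m j) ^ 2) (gaussianPi m v) :=
  (measurePreserving_eval (fun i => gaussianReal (m i) (v i)) j).integrable_comp_of_integrable
    (g := fun x => (x - m j) ^ 2) ((memLp_id_gaussianReal 2).sub (memLp_const _)).integrable_sq

theorem integral_eval_sub_sq_gaussianPi (m : ι → ℝ) (v : ι → ℝ≥0) (j : ι) :
    ∫ x, (x j - m j) ^ 2 ∂gaussianPi m v = v j := by
  have hvar := variance_fun_id_gaussianReal (μ := m j) (v := v j)
  rw [variance_eq_integral (by fun_prop), integral_id_gaussianReal,
    ← (measurePreserving_eval (fun i => gaussianReal (m i) (v i)) j).map_eq,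
    integral_map (measurable_pi_apply j).aemeasurable (by fun_prop)] at hvar
  exact hvar

end GaussianPi

section InverseMoment

theorem ofReal_inv_eq_lintegral_exp_neg_mul {q : ℝ} (hq : 0 < q) :
    ENNReal.ofReal q⁻¹ = ∫⁻ t in Ioi 0, ENNReal.ofReal (Real.exp (-t * q)) := by
  simp_rw [neg_mul_comm, mul_comm _ (-q)]
  rw [← ofReal_integral_eq_lintegral_ofReal (integrableOn_exp_mul_Ioi (by linarith) 0)
    (ae_of_all _ fun t => (Real.exp_pos _).le), integral_exp_mul_Ioi (by linarith) 0]
  simp [neg_div_neg_eq]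

variable {ι : Type*} {s : Finset ι}

/-- The squared Euclidean norm of the coordinates in `s`. -/
def sqNormOn (s : Finset ι) (x : ι → ℝ) : ℝ := ∑ j ∈ s, x j ^ 2

@[fun_prop]
theorem measurable_sqNormOn (s : Finset ι) : Measurable (sqNormOn s) := by
  unfold sqNormOn
  fun_prop

theorem sqNormOn_nonneg (s : Finset ι) (x : ι → ℝ) : 0 ≤ sqNormOn s x :=
  sum_nonneg fun _ _ => sq_nonneg _

theorem sq_le_sqNormOn {j : ι} (hj : j ∈ s) (x : ι → ℝ) : x j ^ 2 ≤ sqNormOn s x :=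
  single_le_sum (f := fun k => x k ^ 2) (fun _ _ => sq_nonneg _) hj

theorem sqNormOn_update [DecidableEq ι] {j : ι} (hj : j ∈ s) (x : ι → ℝ) (y : ℝ) :
    sqNormOn s (Function.update x j y) = y ^ 2 + sqNormOn (s.erase j) x := by
  rw [sqNormOn, ← add_sum_erase s _ hj, Function.update_self]
  congr 1
  exact sum_congr rfl fun i hi => by rw [Function.update_of_ne (ne_of_mem_erase hi)]

/-- The inverse moment `E[1 / ∑ j ∈ s, X j ^ 2]` of independent `X j ∼ N(0, w j)`, written as the
integral over `t` of the Laplace transform `E[exp (-t * ∑ j ∈ s, X j ^ 2)]`. -/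
noncomputable def inverseMoment (s : Finset ι) (w : ι → ℝ≥0) : ℝ≥0∞ :=
  ∫⁻ t in Ioi (0 : ℝ), ∏ j ∈ s, ENNReal.ofReal (√(1 + 2 * t * w j))⁻¹

theorem lintegral_Ioi_inv_sqrt_pow {w : ℝ} (hw : 0 < w) {k : ℕ} (hk : k ≠ 0) :
    ∫⁻ t in Ioi 0, ENNReal.ofReal ((√(1 + 2 * t * w))⁻¹ ^ (k + 2)) =
      ENNReal.ofReal (1 / (w * k)) := by
  have hderiv (t : ℝ) (ht : t ∈ Ici (0 : ℝ)) :
      HasDerivAt (fun t => -(1 / (w * k)) * (√(1 + 2 * t * w))⁻¹ ^ k)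
        ((√(1 + 2 * t * w))⁻¹ ^ (k + 2)) t := by
    have ht' : (0 : ℝ) ≤ t := ht
    have hpos : 0 < 1 + 2 * t * w := by positivity
    have haffine : HasDerivAt (fun t => 1 + 2 * t * w) (2 * w) t := by
      simpa using (((hasDerivAt_id t).const_mul 2).mul_const w).const_add 1
    convert! (((haffine.sqrt hpos.ne').inv (by positivity)).pow k).const_mul (-(1 / (w * k)))
      using 1
    obtain ⟨k, rfl⟩ := Nat.exists_eq_succ_of_ne_zero hk
    simp only [Nat.succ_eq_add_one, add_tsub_cancel_right, Pi.inv_apply, inv_pow]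
    field_simp
    ring
  have hlim : Tendsto (fun t => -(1 / (w * k)) * (√(1 + 2 * t * w))⁻¹ ^ k) atTop (𝓝 0) := by
    have haffine : Tendsto (fun t : ℝ => 1 + 2 * t * w) atTop atTop :=
      tendsto_atTop_add_const_left _ _
        ((tendsto_id.const_mul_atTop two_pos).atTop_mul_const hw)
    simpa [hk] using
      ((Real.tendsto_sqrt_atTop.comp haffine).inv_tendsto_atTop.pow k).const_mul (-(1 / (w * k)))
  have hpos (t : ℝ) (_ : t ∈ Ioi (0 : ℝ)) : 0 ≤ (√(1 + 2 * t * w))⁻¹ ^ (k + 2) := by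
    positivity
  rw [← ofReal_integral_eq_lintegral_ofReal
    (integrableOn_Ioi_deriv_of_nonneg' hderiv hpos hlim) (ae_of_all _ fun t => by positivity),
    integral_Ioi_of_hasDerivAt_of_nonneg' hderiv hpos hlim]
  simp

theorem inverseMoment_eq_of_forall_eq (hs : 3 ≤ #s) {w : ι → ℝ≥0} {w₀ : ℝ≥0} (hw₀ : w₀ ≠ 0)
    (hw : ∀ j ∈ s, w j = w₀) :
    inverseMoment s w = ENNReal.ofReal (1 / (w₀ * (#s - 2))) := by
  obtain ⟨k, hk⟩ := Nat.exists_eq_add_of_le' (show 2 ≤ #s by lia)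
  have hprod (t : ℝ) : ∏ j ∈ s, ENNReal.ofReal (√(1 + 2 * t * w j))⁻¹ =
      ENNReal.ofReal ((√(1 + 2 * t * w₀))⁻¹ ^ (k + 2)) := by
    rw [ENNReal.ofReal_pow (by positivity), ← hk]
    exact prod_eq_pow_card fun j hj => by rw [hw j hj]
  simp_rw [inverseMoment, hprod]
  rw [lintegral_Ioi_inv_sqrt_pow (by positivity) (by lia), hk]
  simp

variable [Fintype ι] {v : ι → ℝ≥0}

theorem ae_sqNormOn_pos (m : ι → ℝ) (hv : ∃ j ∈ s, v j ≠ 0) :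
    ∀ᵐ x ∂gaussianPi m v, 0 < sqNormOn s x := by
  obtain ⟨j, hj, hvj⟩ := hv
  have : NullSingletonClass (gaussianReal (m j) (v j)) := nullSingletonClass_gaussianReal hvj
  filter_upwards [Measure.ae_eval_ne (μ := fun i => gaussianReal (m i) (v i)) j 0] with x hx
  exact (by positivity : 0 < x j ^ 2).trans_le (sq_le_sqNormOn hj x)

theorem lintegral_exp_neg_mul_sqNormOn (s : Finset ι) (m : ι → ℝ) (v : ι → ℝ≥0) {t : ℝ}
    (ht : 0 ≤ t) :
    ∫⁻ x, ENNReal.ofReal (Real.exp (-t * sqNormOn s x)) ∂gaussianPi m v =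
      ∏ j ∈ s, ENNReal.ofReal (Real.exp (-(t / (1 + 2 * t * v j)) * m j ^ 2)) *
        ENNReal.ofReal (√(1 + 2 * t * v j))⁻¹ := by
  simp_rw [sqNormOn, mul_sum, Real.exp_sum,
    ENNReal.ofReal_prod_of_nonneg fun _ _ => (Real.exp_pos _).le]
  rw [lintegral_pi_prod _ s (f := fun _ y => ENNReal.ofReal (Real.exp (-t * y ^ 2))) (by fun_prop)]
  simp_rw [lintegral_exp_neg_mul_sq_gaussianReal _ _ ht]

theorem lintegral_inv_sqNormOn (m : ι → ℝ) (hv : ∃ j ∈ s, v j ≠ 0) :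
    ∫⁻ x, ENNReal.ofReal (sqNormOn s x)⁻¹ ∂gaussianPi m v =
      ∫⁻ t in Ioi 0, ∏ j ∈ s, ENNReal.ofReal (Real.exp (-(t / (1 + 2 * t * v j)) * m j ^ 2)) *
        ENNReal.ofReal (√(1 + 2 * t * v j))⁻¹ := by
  rw [lintegral_congr_ae ((ae_sqNormOn_pos m hv).mono fun x hx =>
    ofReal_inv_eq_lintegral_exp_neg_mul hx), lintegral_lintegral_swap (by fun_prop)]
  exact setLIntegral_congr_fun measurableSet_Ioi fun t ht =>
    lintegral_exp_neg_mul_sqNormOn s m v (le_of_lt ht)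

theorem lintegral_inv_sqNormOn_le (m : ι → ℝ) (hv : ∃ j ∈ s, v j ≠ 0) :
    ∫⁻ x, ENNReal.ofReal (sqNormOn s x)⁻¹ ∂gaussianPi m v ≤ inverseMoment s v := by
  rw [lintegral_inv_sqNormOn m hv]
  refine setLIntegral_mono (by fun_prop) fun t (ht : 0 < t) => prod_le_prod' fun j _ => ?_
  refine mul_le_of_le_one_left' (ENNReal.ofReal_le_one.2 (Real.exp_le_one_iff.2 ?_))
  rw [neg_mul, neg_nonpos]
  positivity

theorem measurable_lintegral_inv_sqNormOn (hv : ∃ j ∈ s, v j ≠ 0) :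
    Measurable fun m => ∫⁻ x, ENNReal.ofReal (sqNormOn s x)⁻¹ ∂gaussianPi m v := by
  simp_rw [fun m => lintegral_inv_sqNormOn m hv]
  exact Measurable.lintegral_prod_right (by fun_prop)

theorem lintegral_lintegral_inv_sqNormOn (l : ι → ℝ≥0) (hv : ∃ j ∈ s, v j ≠ 0) :
    ∫⁻ m, ∫⁻ x, ENNReal.ofReal (sqNormOn s x)⁻¹ ∂gaussianPi m v ∂gaussianPi 0 l =
      inverseMoment s (l + v) := by
  simp_rw [fun m => lintegral_inv_sqNormOn m hv]
  rw [lintegral_lintegral_swap (by fun_prop)]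
  refine setLIntegral_congr_fun measurableSet_Ioi fun t (ht : 0 < t) => ?_
  rw [lintegral_pi_prod _ s (f := fun j y => ENNReal.ofReal
    (Real.exp (-(t / (1 + 2 * t * v j)) * y ^ 2)) * ENNReal.ofReal (√(1 + 2 * t * v j))⁻¹)
    (by fun_prop)]
  refine prod_congr rfl fun j _ => ?_
  rw [lintegral_mul_const _ (by fun_prop),
    lintegral_exp_neg_mul_sq_gaussianReal _ _ (by positivity), Pi.zero_apply, zero_pow two_ne_zero,
    mul_zero, Real.exp_zero, ENNReal.ofReal_one, one_mul, ← ENNReal.ofReal_mul (by positivity),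
    ← mul_inv, ← Real.sqrt_mul (by positivity), Pi.add_apply, NNReal.coe_add]
  congr 3
  field_simp
  ring

theorem integrable_inv_sqNormOn (hs : 3 ≤ #s) (m : ι → ℝ) {v : ℝ≥0} (hv : v ≠ 0) :
    Integrable (fun x => (sqNormOn s x)⁻¹) (gaussianPi m fun _ => v) := by
  obtain ⟨j, hj⟩ := card_pos.1 (show 0 < #s by lia)
  refine ⟨Measurable.aestronglyMeasurable (by fun_prop), ?_⟩
  rw [hasFiniteIntegral_iff_ofReal (ae_of_all _ fun x => inv_nonneg.2 (sqNormOn_nonneg s x))]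
  refine (lintegral_inv_sqNormOn_le m ⟨j, hj, hv⟩).trans_lt ?_
  rw [inverseMoment_eq_of_forall_eq hs hv fun _ _ => rfl]
  exact ENNReal.ofReal_lt_top

end InverseMoment

section JamesSteinCoordinates

theorem hasDerivAt_div_sq_add {q : ℝ} (hq : 0 < q) (y : ℝ) :
    HasDerivAt (fun y => y / (y ^ 2 + q)) ((y ^ 2 + q)⁻¹ - 2 * (y / (y ^ 2 + q)) ^ 2) y := by
  have hpos : 0 < y ^ 2 + q := by positivity
  convert! (hasDerivAt_id y).div (((hasDerivAt_id y).pow 2).add_const q) hpos.ne' using 1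
  simp only [Pi.pow_apply, id_eq, one_mul, Nat.cast_ofNat, Nat.add_one_sub_one, pow_one, mul_one]
  field_simp

theorem div_sq_le_inv {x q : ℝ} (h : x ^ 2 ≤ q) : (x / q) ^ 2 ≤ q⁻¹ := by
  rcases ((sq_nonneg x).trans h).eq_or_lt with rfl | hq
  · simp
  · rw [div_pow, div_le_iff₀ (by positivity), sq q, inv_mul_cancel_left₀ hq.ne']
    exact h

variable {ι : Type*} {s : Finset ι} {m : ι → ℝ} {v : ℝ≥0}

theorem sum_div_sqNormOn_sq (s : Finset ι) (x : ι → ℝ) :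
    ∑ j ∈ s, (x j / sqNormOn s x) ^ 2 = (sqNormOn s x)⁻¹ := by
  simp_rw [div_pow]
  rw [← sum_div, ← sqNormOn, sq]
  exact div_self_mul_self' _

/-- James–Stein shrinkage towards `0` of the coordinates in `s`, with shrinkage constant `c`; the
other coordinates are kept. -/
noncomputable def shrinkOn [DecidableEq ι] (s : Finset ι) (c : ℝ) (x : ι → ℝ) (j : ι) : ℝ :=
  x j - if j ∈ s then c * (x j / sqNormOn s x) else 0

@[fun_prop]
theorem measurable_shrinkOn [DecidableEq ι] (s : Finset ι) (c : ℝ) (j : ι) :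
    Measurable fun x => shrinkOn s c x j := by
  unfold shrinkOn
  split_ifs <;> fun_prop

variable [Fintype ι]

theorem memLp_eval_div_sqNormOn {j : ι} (hj : j ∈ s) (hs : 3 ≤ #s) (hv : v ≠ 0) :
    MemLp (fun x => x j / sqNormOn s x) 2 (gaussianPi m fun _ => v) := by
  have hmeas : Measurable fun x : ι → ℝ => x j / sqNormOn s x := by fun_prop
  refine (memLp_two_iff_integrable_sq hmeas.aestronglyMeasurable).2 ?_
  refine (integrable_inv_sqNormOn hs m hv).mono' (hmeas.pow_const 2).aestronglyMeasurable
    (ae_of_all _ fun x => ?_)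
  rw [Real.norm_of_nonneg (sq_nonneg _)]
  exact div_sq_le_inv (sq_le_sqNormOn hj x)

theorem integrable_eval_sub_mul_div_sqNormOn {j : ι} (hj : j ∈ s) (hs : 3 ≤ #s) (hv : v ≠ 0) :
    Integrable (fun x => (x j - m j) * (x j / sqNormOn s x)) (gaussianPi m fun _ => v) := by
  have hnoise : MemLp (fun x => x j - m j) 2 (gaussianPi m fun _ => v) :=
    (memLp_two_iff_integrable_sq (Measurable.aestronglyMeasurable (by fun_prop))).2
      (integrable_eval_sub_sq_gaussianPi m _ j)
  exact hnoise.integrable_mul (memLp_eval_div_sqNormOn hj hs hv)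

theorem integral_eval_sub_mul_div_sqNormOn {j : ι} (hj : j ∈ s) (hs : 3 ≤ #s) (hv : v ≠ 0) :
    ∫ x, (x j - m j) * (x j / sqNormOn s x) ∂gaussianPi m (fun _ => v) =
      v * ∫ x, ((sqNormOn s x)⁻¹ - 2 * (x j / sqNormOn s x) ^ 2) ∂gaussianPi m fun _ => v := by
  classical
  have hmemLp := memLp_eval_div_sqNormOn (m := m) hj hs hv
  obtain ⟨k, hk⟩ := card_pos.1 (show 0 < #(s.erase j) by rw [card_erase_of_mem hj]; lia)
  refine integral_eval_sub_mul_gaussianPi (F := fun x => x j / sqNormOn s x)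
    (F' := fun x => (sqNormOn s x)⁻¹ - 2 * (x j / sqNormOn s x) ^ 2) ?_
    (hmemLp.integrable one_le_two) (integrable_eval_sub_mul_div_sqNormOn hj hs hv)
    ((integrable_inv_sqNormOn hs m hv).sub (hmemLp.integrable_sq.const_mul 2))
  filter_upwards [ae_sqNormOn_pos m ⟨k, hk, hv⟩] with x hx y
  simpa only [sqNormOn_update hj, Function.update_self] using hasDerivAt_div_sq_add hx y

theorem integral_sum_eval_sub_mul_div_sqNormOn (hs : 3 ≤ #s) (hv : v ≠ 0) :
    ∫ x, ∑ j ∈ s, (x j - m j) * (x j / sqNormOn s x) ∂gaussianPi m (fun _ => v) =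
      v * (#s - 2) * ∫ x, (sqNormOn s x)⁻¹ ∂gaussianPi m fun _ => v := by
  have hint (j) (hj : j ∈ s) : Integrable
      (fun x => (sqNormOn s x)⁻¹ - 2 * (x j / sqNormOn s x) ^ 2) (gaussianPi m fun _ => v) :=
    (integrable_inv_sqNormOn hs m hv).sub
      ((memLp_eval_div_sqNormOn hj hs hv).integrable_sq.const_mul 2)
  rw [integral_finsetSum _ fun j hj => integrable_eval_sub_mul_div_sqNormOn hj hs hv,
    sum_congr rfl fun j hj => integral_eval_sub_mul_div_sqNormOn hj hs hv, ← mul_sum,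
    ← integral_finsetSum _ hint, mul_assoc, ← integral_const_mul ((#s : ℝ) - 2)]
  congr 2 with x
  rw [sum_sub_distrib, ← mul_sum, sum_div_sqNormOn_sq, sum_const, nsmul_eq_mul, sub_mul]

variable [DecidableEq ι]

theorem sum_shrinkOn_sub_sq (s : Finset ι) (c : ℝ) (x m : ι → ℝ) :
    ∑ j, (shrinkOn s c x j - m j) ^ 2 =
      ∑ j, (x j - m j) ^ 2 - 2 * c * ∑ j ∈ s, (x j - m j) * (x j / sqNormOn s x) +
        c ^ 2 * (sqNormOn s x)⁻¹ := by
  rw [← sum_div_sqNormOn_sq, mul_sum, mul_sum, ← sum_ite_mem_eq s, ← sum_ite_mem_eq s,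
    ← sum_sub_distrib, ← sum_add_distrib]
  refine sum_congr rfl fun j _ => ?_
  rw [shrinkOn]
  split_ifs <;> ring

theorem integrable_and_integral_sum_shrinkOn_sub_sq (hs : 3 ≤ #s) (c : ℝ) (m : ι → ℝ)
    (hv : v ≠ 0) :
    Integrable (fun x => ∑ j, (shrinkOn s c x j - m j) ^ 2) (gaussianPi m fun _ => v) ∧
      ∫ x, ∑ j, (shrinkOn s c x j - m j) ^ 2 ∂gaussianPi m (fun _ => v) =
        v * Fintype.card ι -
          c * (2 * (v * (#s - 2)) - c) * ∫ x, (sqNormOn s x)⁻¹ ∂gaussianPi m fun _ => v := by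
  have hinv := (integrable_inv_sqNormOn hs m hv).const_mul (c ^ 2)
  have hnoise : Integrable (fun x => ∑ j, (x j - m j) ^ 2) (gaussianPi m fun _ => v) :=
    integrable_finsetSum _ fun j _ => integrable_eval_sub_sq_gaussianPi m _ j
  have hcross : Integrable (fun x => 2 * c * ∑ j ∈ s, (x j - m j) * (x j / sqNormOn s x))
      (gaussianPi m fun _ => v) :=
    (integrable_finsetSum _ fun j hj =>
      integrable_eval_sub_mul_div_sqNormOn hj hs hv).const_mul _
  have hdiff : Integrable (fun x => ∑ j, (x j - m j) ^ 2 -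
      2 * c * ∑ j ∈ s, (x j - m j) * (x j / sqNormOn s x)) (gaussianPi m fun _ => v) :=
    hnoise.sub hcross
  simp_rw [sum_shrinkOn_sub_sq]
  refine ⟨hdiff.add hinv, ?_⟩
  rw [integral_add hdiff hinv, integral_sub hnoise hcross, integral_const_mul, integral_const_mul,
    integral_sum_eval_sub_mul_div_sqNormOn hs hv,
    integral_finsetSum _ fun j _ => integrable_eval_sub_sq_gaussianPi m _ j]
  simp_rw [integral_eval_sub_sq_gaussianPi]
  rw [sum_const, card_univ, nsmul_eq_mul]
  ring

theorem lintegral_sum_shrinkOn_sub_sq_add (hs : 3 ≤ #s) (m : ι → ℝ) (hv : v ≠ 0) :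
    ∫⁻ x, ENNReal.ofReal (∑ j, (shrinkOn s (v * (#s - 2)) x j - m j) ^ 2)
        ∂gaussianPi m (fun _ => v) +
      ENNReal.ofReal ((v * (#s - 2)) ^ 2) *
        ∫⁻ x, ENNReal.ofReal (sqNormOn s x)⁻¹ ∂gaussianPi m (fun _ => v) =
      ENNReal.ofReal (v * Fintype.card ι) := by
  obtain ⟨hint, hvalue⟩ := integrable_and_integral_sum_shrinkOn_sub_sq hs (v * (#s - 2)) m hv
  have hnonneg (x : ι → ℝ) : 0 ≤ (sqNormOn s x)⁻¹ := inv_nonneg.2 (sqNormOn_nonneg s x)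
  rw [← ofReal_integral_eq_lintegral_ofReal hint
      (ae_of_all _ fun x => sum_nonneg fun j _ => sq_nonneg _),
    ← ofReal_integral_eq_lintegral_ofReal (integrable_inv_sqNormOn hs m hv) (ae_of_all _ hnonneg),
    ← ENNReal.ofReal_mul (sq_nonneg _),
    ← ENNReal.ofReal_add (integral_nonneg fun x => sum_nonneg fun j _ => sq_nonneg _)
      (mul_nonneg (sq_nonneg _) (integral_nonneg hnonneg)), hvalue]
  congr 1
  ring

end JamesSteinCoordinates

section JamesStein

variable {E : Type*} [NormedAddCommGroup E] [InnerProductSpace ℝ E] (V : Submodule ℝ E)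
  [V.HasOrthogonalProjection]

/-- The James–Stein estimator with shrinkage constant `c`: it shrinks the component of the
observation in `V` towards `0` and keeps the component in `Vᗮ`. -/
noncomputable def jamesStein (c : ℝ) (x : E) : E :=
  x - (c / ‖V.starProjection x‖ ^ 2) • V.starProjection x

variable {V} {ι : Type*} [Fintype ι] {b : OrthonormalBasis ι ℝ E} {s : Finset ι}

theorem repr_starProjection [DecidableEq ι] (hmem : ∀ j ∈ s, b j ∈ V)
    (horth : ∀ j ∉ s, b j ∈ Vᗮ) (x : E) (j : ι) :
    b.repr (V.starProjection x) j = if j ∈ s then b.repr x j else 0 := by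
  rw [b.repr_apply_apply, ← Submodule.inner_starProjection_left_eq_right]
  split_ifs with hj
  · rw [Submodule.starProjection_eq_self_iff.2 (hmem j hj), b.repr_apply_apply]
  · rw [(Submodule.starProjection_apply_eq_zero_iff V).2 (horth j hj), inner_zero_left]

theorem norm_starProjection_sq (hmem : ∀ j ∈ s, b j ∈ V) (horth : ∀ j ∉ s, b j ∈ Vᗮ) (x : E) :
    ‖V.starProjection x‖ ^ 2 = sqNormOn s (b.repr x) := by
  classical
  rw [← b.repr.norm_map, EuclideanSpace.real_norm_sq_eq, sqNormOn, ← sum_ite_mem_eq s]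
  refine sum_congr rfl fun j _ => ?_
  rw [repr_starProjection hmem horth]
  split_ifs <;> simp

variable [DecidableEq ι]

theorem repr_jamesStein (hmem : ∀ j ∈ s, b j ∈ V) (horth : ∀ j ∉ s, b j ∈ Vᗮ) (c : ℝ) (x : E)
    (j : ι) : b.repr (jamesStein V c x) j = shrinkOn s c (b.repr x) j := by
  rw [jamesStein, map_sub, map_smul, PiLp.sub_apply, PiLp.smul_apply,
    repr_starProjection hmem horth, norm_starProjection_sq hmem horth, shrinkOn, smul_ite,
    smul_zero, smul_eq_mul, div_mul_comm, mul_comm]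

theorem norm_jamesStein_sub_sq (hmem : ∀ j ∈ s, b j ∈ V) (horth : ∀ j ∉ s, b j ∈ Vᗮ) (c : ℝ)
    (x m : E) :
    ‖jamesStein V c x - m‖ ^ 2 = ∑ j, (shrinkOn s c (b.repr x) j - b.repr m j) ^ 2 := by
  rw [← b.repr.norm_map, map_sub, EuclideanSpace.real_norm_sq_eq]
  simp_rw [PiLp.sub_apply, repr_jamesStein hmem horth]

end JamesStein

section Laws

theorem measurePreserving_repr_multivariateGaussian {ι κ : Type*} [Fintype ι] [DecidableEq ι]
    [Fintype κ] (b : OrthonormalBasis κ ℝ (EuclideanSpace ℝ ι)) (m : EuclideanSpace ℝ ι)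
    {S : Matrix ι ι ℝ} (hS : S.PosSemidef) {l : κ → ℝ≥0}
    (hdiag : ∀ x : EuclideanSpace ℝ ι, x ⬝ᵥ S *ᵥ x = ∑ j, l j * ⟪b j, x⟫ ^ 2) :
    MeasurePreserving (fun x j => b.repr x j) (multivariateGaussian m S)
      (gaussianPi (b.repr m) l) := by
  have hmap : (multivariateGaussian m S).map b.repr =
      (gaussianPi (b.repr m) l).map (WithLp.toLp 2) := by
    refine Measure.ext_of_charFun (funext fun t => ?_)
    have hcharFun : charFun ((multivariateGaussian m S).map b.repr) t =
        charFun (multivariateGaussian m S) (b.repr.symm t) := by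
      rw [charFun_apply, charFun_apply, integral_map (by fun_prop) (by fun_prop)]
      simp_rw [b.repr.inner_map_eq_flip]
    rw [hcharFun, charFun_multivariateGaussian hS, hdiag, charFun_pi]
    simp_rw [charFun_gaussianReal, ← Complex.exp_sum, ← b.repr_apply_apply,
      b.repr.apply_symm_apply, sum_sub_distrib, ← sum_div]
    congr 2
    · rw [b.repr.symm.inner_map_eq_flip]
      simp [PiLp.inner_apply, mul_sum, mul_comm]
    · push_cast
      rfl
  refine ⟨by fun_prop, ?_⟩
  change (multivariateGaussian m S).map (WithLp.ofLp ∘ b.repr) = _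
  rw [← Measure.map_map (by fun_prop) (by fun_prop), hmap,
    Measure.map_map (by fun_prop) (by fun_prop)]
  exact Measure.map_id

variable {n d : ℕ}

/-- The vector of the sample means as a point of Euclidean space. -/
noncomputable def meanVec (Y : Fin n → Fin d → ℝ) : EuclideanSpace ℝ (Fin d) :=
  WithLp.toLp 2 (sampleMean Y)

theorem meanVec_eq_smul_sum (Y : Fin n → Fin d → ℝ) :
    meanVec Y = (n : ℝ)⁻¹ • ∑ i, WithLp.toLp 2 (Y i) := by
  ext j
  simp [meanVec, sampleMean]

theorem posSemidef_inv_smul_one (n d : ℕ) :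
    ((n : ℝ)⁻¹ • (1 : Matrix (Fin d) (Fin d) ℝ)).PosSemidef :=
  Matrix.PosSemidef.one.smul (by positivity)

theorem measurePreserving_meanVec (hn : n ≠ 0) (μ : EuclideanSpace ℝ (Fin d)) :
    MeasurePreserving meanVec (dataLaw n μ) (multivariateGaussian μ ((n : ℝ)⁻¹ • 1)) := by
  have : IsProbabilityMeasure (dataLaw n μ) := by unfold dataLaw; infer_instance
  have hmeas : Measurable (meanVec (n := n) (d := d)) := by
    simp_rw [funext meanVec_eq_smul_sum]
    fun_prop
  have hindep : iIndepFun (fun i (Y : Fin n → Fin d → ℝ) => WithLp.toLp 2 (Y i)) (dataLaw n μ) :=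
    iIndepFun_pi (X := fun _ => WithLp.toLp 2) fun _ => by fun_prop
  have hrow (i : Fin n) : (dataLaw n μ).map (fun Y => WithLp.toLp 2 (Y i)) =
      (Measure.pi fun j => gaussianReal (μ j) 1).map (WithLp.toLp 2) := by
    rw [← (measurePreserving_eval (fun _ : Fin n => Measure.pi fun j => gaussianReal (μ j) 1)
      i).map_eq, Measure.map_map (by fun_prop) (by fun_prop)]
    rfl
  refine ⟨hmeas, Measure.ext_of_charFun (funext fun t => ?_)⟩
  rw [charFun_multivariateGaussian (posSemidef_inv_smul_one n d), funext meanVec_eq_smul_sum,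
    charFun_map_smul_comp (Measurable.aemeasurable (by fun_prop)),
    hindep.charFun_map_fun_sum_eq_prod fun i => Measurable.aemeasurable (by fun_prop)]
  simp_rw [hrow]
  rw [prod_const, card_univ, Fintype.card_fin, Pi.pow_apply, charFun_pi]
  simp_rw [charFun_gaussianReal, ← Complex.exp_sum, ← Complex.exp_nat_mul]
  congr 1
  rw [Matrix.smul_mulVec, Matrix.one_mulVec, dotProduct_smul, smul_eq_mul]
  simp only [PiLp.inner_apply, dotProduct]
  push_cast
  rw [mul_sum, mul_sum, sum_mul, sum_div, ← sum_sub_distrib]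
  refine sum_congr rfl fun j _ => ?_
  simp only [PiLp.smul_apply, smul_eq_mul, Complex.ofReal_mul, Complex.ofReal_inv,
    Complex.ofReal_natCast, one_mul, RCLike.inner_apply, Real.ringHom_apply]
  field_simp

end Laws

section Risk

variable {n d : ℕ} {V : Submodule ℝ (EuclideanSpace ℝ (Fin d))}
  {b : OrthonormalBasis (Fin d) ℝ (EuclideanSpace ℝ (Fin d))} {s : Finset (Fin d)}

theorem measurePreserving_repr_meanVec (hn : n ≠ 0)
    (b : OrthonormalBasis (Fin d) ℝ (EuclideanSpace ℝ (Fin d))) (μ : EuclideanSpace ℝ (Fin d)) :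
    MeasurePreserving (fun Y j => b.repr (meanVec Y) j) (dataLaw n μ)
      (gaussianPi (b.repr μ) fun _ => (n : ℝ≥0)⁻¹) := by
  refine (measurePreserving_repr_multivariateGaussian b μ (posSemidef_inv_smul_one n d)
    fun x => ?_).comp (measurePreserving_meanVec hn μ)
  rw [← mul_sum, b.sum_sq_inner_right, EuclideanSpace.real_norm_sq_eq, Matrix.smul_mulVec,
    Matrix.one_mulVec, dotProduct_smul]
  simp [dotProduct, sq]

theorem risk_jamesStein_add (hn : n ≠ 0) (hs : 3 ≤ #s) (hmem : ∀ j ∈ s, b j ∈ V)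
    (horth : ∀ j ∉ s, b j ∈ Vᗮ) (μ : EuclideanSpace ℝ (Fin d)) :
    risk (fun Y : Fin n → Fin d → ℝ => jamesStein V ((#s - 2) / n) (meanVec Y)) μ +
      ENNReal.ofReal (((#s - 2) / n) ^ 2) * ∫⁻ x, ENNReal.ofReal (sqNormOn s x)⁻¹
        ∂gaussianPi (b.repr μ) (fun _ => (n : ℝ≥0)⁻¹) = ENNReal.ofReal (d / n) := by
  have hscale (a : ℝ) : a / n = ((n : ℝ≥0)⁻¹ : ℝ≥0) * a := by simp [div_eq_inv_mul]
  simp_rw [risk, norm_jamesStein_sub_sq hmem horth]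
  rw [(measurePreserving_repr_meanVec hn b μ).lintegral_comp (f := fun x => ENNReal.ofReal
    (∑ j, (shrinkOn s ((#s - 2) / n) x j - b.repr μ j) ^ 2)) (by fun_prop), hscale, hscale,
    lintegral_sum_shrinkOn_sub_sq_add hs _ (by positivity), Fintype.card_fin]

theorem integratedRisk_jamesStein_add (hn : n ≠ 0) (hs : 3 ≤ #s) (hmem : ∀ j ∈ s, b j ∈ V)
    (horth : ∀ j ∉ s, b j ∈ Vᗮ) {S : Matrix (Fin d) (Fin d) ℝ} (hS : S.PosSemidef)
    {l : Fin d → ℝ≥0}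
    (hdiag : ∀ x : EuclideanSpace ℝ (Fin d), x ⬝ᵥ S *ᵥ x = ∑ j, l j * ⟪b j, x⟫ ^ 2) :
    integratedRisk (fun Y : Fin n → Fin d → ℝ => jamesStein V ((#s - 2) / n) (meanVec Y))
        (multivariateGaussian 0 S) +
      ENNReal.ofReal (((#s - 2) / n) ^ 2) * inverseMoment s (l + fun _ => (n : ℝ≥0)⁻¹) =
      ENNReal.ofReal (d / n) := by
  obtain ⟨j, hj⟩ := card_pos.1 (show 0 < #s by lia)
  have hv : ∃ j ∈ s, (fun _ : Fin d => (n : ℝ≥0)⁻¹) j ≠ 0 := ⟨j, hj, by positivity⟩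
  have hprior := measurePreserving_repr_multivariateGaussian b 0 hS hdiag
  rw [map_zero, WithLp.ofLp_zero] at hprior
  have hmeas := measurable_lintegral_inv_sqNormOn hv
  have hmeas_repr : Measurable fun μ => ∫⁻ x, ENNReal.ofReal (sqNormOn s x)⁻¹
      ∂gaussianPi (b.repr μ) (fun _ => (n : ℝ≥0)⁻¹) := hmeas.comp hprior.measurable
  rw [← lintegral_lintegral_inv_sqNormOn l hv, ← hprior.lintegral_comp hmeas, integratedRisk,
    ← lintegral_const_mul _ hmeas_repr, ← lintegral_add_right _ (hmeas_repr.const_mul _)]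
  simp_rw [risk_jamesStein_add hn hs hmem horth]
  simp

end Risk

section Substitution

theorem image_Ioo_mul_inv_sub_one {c : ℝ} (hc : 0 < c) :
    (fun u : ℝ => c * (u⁻¹ - 1)) '' Ioo 0 1 = Set.Ioi 0 := by
  ext t
  constructor
  · rintro ⟨u, ⟨hu₀, hu₁⟩, rfl⟩
    exact mul_pos hc (sub_pos.2 ((one_lt_inv₀ hu₀).2 hu₁))
  · intro (ht : 0 < t)
    refine ⟨(1 + t / c)⁻¹, ⟨by positivity, inv_lt_one_of_one_lt₀ ?_⟩, ?_⟩
    · exact lt_add_of_pos_right 1 (by positivity)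
    · simp only [inv_inv, add_sub_cancel_left, mul_div_cancel₀ t hc.ne']

theorem lintegral_Ioi_eq_lintegral_Ioo {c : ℝ} (hc : 0 < c) (f : ℝ → ℝ≥0∞) :
    ∫⁻ t in Ioi 0, f t = ∫⁻ u in Ioo (0 : ℝ) 1, ENNReal.ofReal (c / u ^ 2) * f (c * (u⁻¹ - 1)) := by
  have hderiv (u : ℝ) (hu : u ∈ Ioo (0 : ℝ) 1) :
      HasDerivWithinAt (fun u : ℝ => c * (u⁻¹ - 1)) (c * -(u ^ 2)⁻¹) (Ioo 0 1) u :=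
    (((hasDerivAt_inv hu.1.ne').sub_const 1).const_mul c).hasDerivWithinAt
  have hinj : InjOn (fun u : ℝ => c * (u⁻¹ - 1)) (Ioo 0 1) := fun a _ b _ hab => by
    simpa [hc.ne'] using hab
  rw [← image_Ioo_mul_inv_sub_one hc,
    lintegral_image_eq_lintegral_abs_deriv_mul measurableSet_Ioo hderiv hinj]
  refine setLIntegral_congr_fun measurableSet_Ioo fun u _ => ?_
  rw [mul_neg, abs_neg, abs_of_nonneg (by positivity), div_eq_mul_inv]

variable {ι : Type*} (s : Finset ι) (l : ι → ℝ≥0) {κ : ℝ≥0}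

theorem div_sq_mul_prod_inv_sqrt (hκ : κ ≠ 0) {u : ℝ} (hu : u ∈ Ioo (0 : ℝ) 1) :
    κ / 2 / u ^ 2 * ∏ j ∈ s, (√(1 + 2 * (κ / 2 * (u⁻¹ - 1)) * (l j + (κ : ℝ)⁻¹)))⁻¹ =
      κ / 2 * (u ^ ((#s - 2) / 2 - 1 : ℝ) / √(∏ j ∈ s, (1 + κ * l j * (1 - u)))) := by
  obtain ⟨hu₀, hu₁⟩ := hu
  have hfactor (j : ι) : 1 + 2 * (κ / 2 * (u⁻¹ - 1)) * (l j + (κ : ℝ)⁻¹) =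
      (1 + κ * l j * (1 - u)) / u := by
    have : (κ : ℝ) ≠ 0 := by exact_mod_cast hκ
    field_simp
    ring
  have hpos (j : ι) : 0 ≤ 1 + κ * l j * (1 - u) := by
    have : 0 ≤ 1 - u := by linarith
    positivity
  have hpow : u ^ ((#s - 2) / 2 - 1 : ℝ) = √u ^ #s / u ^ 2 := by
    rw [Real.sqrt_eq_rpow, ← Real.rpow_natCast, ← Real.rpow_natCast, ← Real.rpow_mul hu₀.le,
      ← Real.rpow_sub hu₀]
    congr 1
    push_cast
    ring
  simp_rw [hfactor, Real.sqrt_div (hpos _), inv_div]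
  rw [prod_div_distrib, prod_const, hpow, Real.sqrt_prod s fun j _ => hpos j]
  ring

theorem intervalIntegrable_rpow_div_sqrt_prod {k : ℕ} (hk : 3 ≤ k) (κ : ℝ≥0) :
    IntervalIntegrable (fun u : ℝ => u ^ (((k : ℝ) - 2) / 2 - 1) /
      √(∏ j ∈ s, (1 + κ * l j * (1 - u)))) volume 0 1 := by
  have hk' : (3 : ℝ) ≤ k := by exact_mod_cast hk
  simp_rw [div_eq_mul_inv (_ ^ _)]
  refine (intervalIntegral.intervalIntegrable_rpow' (by linarith)).mul_continuousOn
    (ContinuousOn.inv₀ (by fun_prop) fun u hu => ?_)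
  rw [Set.uIcc_of_le zero_le_one] at hu
  have : 0 ≤ 1 - u := sub_nonneg.2 hu.2
  exact (Real.sqrt_pos.2 (prod_pos fun j _ => by positivity)).ne'

theorem inverseMoment_add_inv (hs : 3 ≤ #s) (hκ : κ ≠ 0) :
    inverseMoment s (l + fun _ => κ⁻¹) = ENNReal.ofReal (κ / 2 * ∫ u in (0 : ℝ)..1,
      u ^ (((#s : ℝ) - 2) / 2 - 1) / √(∏ j ∈ s, (1 + κ * l j * (1 - u)))) := by
  have hκ' : (0 : ℝ) < κ := by positivity
  rw [inverseMoment, lintegral_Ioi_eq_lintegral_Ioo (half_pos hκ'),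
    ← intervalIntegral.integral_const_mul, intervalIntegral.integral_of_le zero_le_one,
    integral_Ioc_eq_integral_Ioo, ofReal_integral_eq_lintegral_ofReal]
  · refine setLIntegral_congr_fun measurableSet_Ioo fun u hu => ?_
    simp only [Pi.add_apply, NNReal.coe_add, NNReal.coe_inv]
    rw [← ENNReal.ofReal_prod_of_nonneg fun _ _ => by positivity,
      ← ENNReal.ofReal_mul (by positivity), div_sq_mul_prod_inv_sqrt s l hκ hu]
  · exact (((intervalIntegrable_iff_integrableOn_Ioo_of_le zero_le_one).1
      (intervalIntegrable_rpow_div_sqrt_prod s l hs κ))).const_mul _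
  · filter_upwards [ae_restrict_mem measurableSet_Ioo] with u hu
    have := hu.1
    positivity

end Substitution

section CompoundSymmetry

variable {n d : ℕ} {ρ : ℝ}

/-- The unit vector along the diagonal of `ℝ^d`: the principal axis of a compound symmetric matrix
which carries the grand mean. -/
noncomputable def meanAxis (d : ℕ) : EuclideanSpace ℝ (Fin d) :=
  WithLp.toLp 2 fun _ => (√d)⁻¹

theorem norm_meanAxis (hd : d ≠ 0) : ‖meanAxis d‖ = 1 := by
  rw [meanAxis, EuclideanSpace.norm_eq]
  simp [hd]

theorem inner_meanAxis (x : EuclideanSpace ℝ (Fin d)) :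
    ⟪meanAxis d, x⟫ = (√d)⁻¹ * ∑ j, x j := by
  rw [mul_sum]
  simp only [meanAxis, PiLp.inner_apply, RCLike.inner_apply, conj_trivial, mul_comm]

theorem exists_orthonormalBasis_eq_meanAxis (i₀ : Fin d) :
    ∃ b : OrthonormalBasis (Fin d) ℝ (EuclideanSpace ℝ (Fin d)), b i₀ = meanAxis d := by
  have horthonormal : Orthonormal ℝ (({i₀} : Set (Fin d)).domRestrict fun _ => meanAxis d) :=
    ⟨fun _ => norm_meanAxis i₀.pos.ne', fun i j hij => (hij (Subsingleton.elim i j)).elim⟩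
  obtain ⟨b, hb⟩ := horthonormal.exists_orthonormalBasis_extension_of_card_eq (by simp)
  exact ⟨b, hb i₀ rfl⟩

theorem mem_orthogonal_meanAxis {i₀ j : Fin d}
    {b : OrthonormalBasis (Fin d) ℝ (EuclideanSpace ℝ (Fin d))} (hb : b i₀ = meanAxis d)
    (hj : j ≠ i₀) : b j ∈ (ℝ ∙ meanAxis d)ᗮ := by
  rw [Submodule.mem_orthogonal_singleton_iff_inner_right, ← hb]
  exact b.orthonormal.2 hj.symm

theorem mem_orthogonal_orthogonal_meanAxis {i₀ j : Fin d}
    {b : OrthonormalBasis (Fin d) ℝ (EuclideanSpace ℝ (Fin d))} (hb : b i₀ = meanAxis d)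
    (hj : j = i₀) : b j ∈ (ℝ ∙ meanAxis d)ᗮᗮ := by
  rw [Submodule.orthogonal_orthogonal, hj, hb]
  exact Submodule.mem_span_singleton_self _

/-- The variances of `N(0, compoundSymm d ρ)` along its principal axes, the axis `i₀` being the
diagonal. -/
noncomputable def axisVar (i₀ : Fin d) (ρ : ℝ) (j : Fin d) : ℝ≥0 :=
  if j = i₀ then (1 + ((d : ℝ) - 1) * ρ).toNNReal else (1 - ρ).toNNReal

theorem coe_axisVar_self {i₀ : Fin d} (hρ : 0 ≤ 1 + ((d : ℝ) - 1) * ρ) :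
    (axisVar i₀ ρ i₀ : ℝ) = 1 + ((d : ℝ) - 1) * ρ := by
  rw [axisVar, if_pos rfl, Real.coe_toNNReal _ hρ]

theorem coe_axisVar_of_ne {i₀ j : Fin d} (hj : j ≠ i₀) (hρ : ρ ≤ 1) :
    (axisVar i₀ ρ j : ℝ) = 1 - ρ := by
  rw [axisVar, if_neg hj, Real.coe_toNNReal _ (sub_nonneg.2 hρ)]

theorem compoundSymm_quadraticForm (ρ : ℝ) (x : Fin d → ℝ) :
    x ⬝ᵥ compoundSymm d ρ *ᵥ x = (1 - ρ) * ∑ i, x i ^ 2 + ρ * (∑ i, x i) ^ 2 := by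
  rw [compoundSymm, Matrix.add_mulVec, Matrix.smul_mulVec, Matrix.smul_mulVec,
    Matrix.one_mulVec, dotProduct_add, dotProduct_smul, dotProduct_smul,
    Matrix.vecMulVec_mulVec, dotProduct_smul]
  simp [dotProduct, sq]

theorem compoundSymm_quadraticForm_eq_sum_axisVar (hρ₀ : 0 ≤ 1 + ((d : ℝ) - 1) * ρ) (hρ₁ : ρ ≤ 1)
    {i₀ : Fin d} {b : OrthonormalBasis (Fin d) ℝ (EuclideanSpace ℝ (Fin d))}
    (hb : b i₀ = meanAxis d) (x : EuclideanSpace ℝ (Fin d)) :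
    x ⬝ᵥ compoundSymm d ρ *ᵥ x = ∑ j, axisVar i₀ ρ j * ⟪b j, x⟫ ^ 2 := by
  have hd : (d : ℝ) ≠ 0 := by exact_mod_cast i₀.pos.ne'
  have hsum : (∑ i, x i) ^ 2 = d * ⟪b i₀, x⟫ ^ 2 := by
    rw [hb, inner_meanAxis, mul_pow, inv_pow, Real.sq_sqrt d.cast_nonneg,
      mul_inv_cancel_left₀ hd]
  have herase : ∑ j ∈ univ.erase i₀, axisVar i₀ ρ j * ⟪b j, x⟫ ^ 2 =
      (1 - ρ) * ∑ j ∈ univ.erase i₀, ⟪b j, x⟫ ^ 2 := by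
    rw [mul_sum]
    exact sum_congr rfl fun j hj => by rw [coe_axisVar_of_ne (ne_of_mem_erase hj) hρ₁]
  rw [compoundSymm_quadraticForm, hsum, ← EuclideanSpace.real_norm_sq_eq, ← b.sum_sq_inner_right,
    ← add_sum_erase _ _ (mem_univ i₀),
    ← add_sum_erase _ (fun j => (axisVar i₀ ρ j : ℝ) * ⟪b j, x⟫ ^ 2) (mem_univ i₀), herase,
    coe_axisVar_self hρ₀]
  ring

theorem posSemidef_compoundSymm (hd : d ≠ 0) (hρ₀ : 0 ≤ 1 + ((d : ℝ) - 1) * ρ) (hρ₁ : ρ ≤ 1) :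
    (compoundSymm d ρ).PosSemidef := by
  obtain ⟨b, hb⟩ := exists_orthonormalBasis_eq_meanAxis ⟨0, Nat.pos_of_ne_zero hd⟩
  refine Matrix.PosSemidef.of_dotProduct_mulVec_nonneg ?_ fun x => ?_
  · ext i j
    simp [compoundSymm, Matrix.vecMulVec_apply, Matrix.one_apply, eq_comm]
  · rw [star_trivial, compoundSymm_quadraticForm_eq_sum_axisVar hρ₀ hρ₁ hb (WithLp.toLp 2 x)]
    exact sum_nonneg fun j _ => mul_nonneg (axisVar _ _ j).coe_nonneg (sq_nonneg _)

theorem prod_one_add_axisVar (n : ℕ) (hρ₀ : 0 ≤ 1 + ((d : ℝ) - 1) * ρ) (hρ₁ : ρ ≤ 1)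
    (i₀ : Fin d) (u : ℝ) :
    ∏ j, (1 + n * axisVar i₀ ρ j * (1 - u)) = xi n d ρ u := by
  rw [xi, ← mul_prod_erase _ _ (mem_univ i₀), coe_axisVar_self hρ₀]
  congr 1
  rw [prod_eq_pow_card fun j hj => by rw [coe_axisVar_of_ne (ne_of_mem_erase hj) hρ₁],
    card_erase_of_mem (mem_univ i₀), card_univ, Fintype.card_fin]

theorem estPHB_eq_jamesStein (Y : Fin n → Fin d → ℝ) :
    estPHB Y = jamesStein ⊤ (((d : ℝ) - 2) / n) (meanVec Y) := by
  ext j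
  simp only [jamesStein, Submodule.starProjection_top, ContinuousLinearMap.id_apply, meanVec,
    estPHB, EuclideanSpace.real_norm_sq_eq, PiLp.sub_apply, PiLp.smul_apply, smul_eq_mul, div_div]
  ring

theorem starProjection_meanAxis_orthogonal_meanVec (hd : d ≠ 0) (Y : Fin n → Fin d → ℝ) :
    (ℝ ∙ meanAxis d)ᗮ.starProjection (meanVec Y) =
      WithLp.toLp 2 fun j => sampleMean Y j - grandMean Y := by
  ext j
  rw [Submodule.starProjection_orthogonal_val,
    Submodule.starProjection_unit_singleton ℝ (norm_meanAxis hd), inner_meanAxis]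
  simp only [PiLp.sub_apply, PiLp.smul_apply, meanAxis, meanVec, grandMean, smul_eq_mul]
  rw [mul_right_comm, ← mul_inv, Real.mul_self_sqrt d.cast_nonneg]

theorem estHB_eq_jamesStein (hd : d ≠ 0) (Y : Fin n → Fin d → ℝ) :
    estHB Y = jamesStein (ℝ ∙ meanAxis d)ᗮ (((d : ℝ) - 3) / n) (meanVec Y) := by
  ext j
  rw [jamesStein, starProjection_meanAxis_orthogonal_meanVec hd, EuclideanSpace.real_norm_sq_eq]
  simp only [estHB, meanVec, PiLp.sub_apply, PiLp.smul_apply, smul_eq_mul, div_div]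
  ring

end CompoundSymmetry

section IntegratedRisk

variable {n d : ℕ} {ρ : ℝ}

theorem ne_top_and_toReal_eq_of_add_ofReal_eq {a : ℝ≥0∞} {x y : ℝ} (hx : 0 ≤ x) (hy : 0 ≤ y)
    (h : a + ENNReal.ofReal x = ENNReal.ofReal y) : a ≠ ⊤ ∧ a.toReal = y - x := by
  have ha : a ≠ ⊤ := by
    rintro rfl
    simp at h
  refine ⟨ha, eq_sub_of_add_eq ?_⟩
  rw [← ENNReal.toReal_ofReal hx, ← ENNReal.toReal_add ha ENNReal.ofReal_ne_top, h,
    ENNReal.toReal_ofReal hy]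

theorem one_add_mul_nonneg_of_neg_one_div_le (hd : 2 ≤ d) (hρ : -1 / ((d : ℝ) - 1) ≤ ρ) :
    0 ≤ 1 + ((d : ℝ) - 1) * ρ := by
  have hd' : (2 : ℝ) ≤ d := by exact_mod_cast hd
  rw [div_le_iff₀ (by linarith)] at hρ
  linarith

theorem integratedRisk_estHB (hn : n ≠ 0) (hd : 4 ≤ d) (hρ₀ : -1 / ((d : ℝ) - 1) ≤ ρ)
    (hρ₁ : ρ ≤ 1) :
    integratedRisk (n := n) (d := d) estHB (multivariateGaussian 0 (compoundSymm d ρ)) ≠ ⊤ ∧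
      (integratedRisk (n := n) (d := d) estHB (multivariateGaussian 0 (compoundSymm d ρ))).toReal =
        (d : ℝ) / n - ((d : ℝ) - 3) / n * (1 / (1 + (n : ℝ) * (1 - ρ))) := by
  let i₀ : Fin d := ⟨0, by lia⟩
  obtain ⟨b, hb⟩ := exists_orthonormalBasis_eq_meanAxis i₀
  have hρ₀' := one_add_mul_nonneg_of_neg_one_div_le (by lia) hρ₀
  have hd' : (4 : ℝ) ≤ d := by exact_mod_cast hd
  have hn' : (n : ℝ) ≠ 0 := by exact_mod_cast hn
  have hρ₁' : 0 ≤ 1 - ρ := sub_nonneg.2 hρ₁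
  have hcard : #(univ.erase i₀) = d - 1 := by simp
  have hcard' : (#(univ.erase i₀) : ℝ) - 2 = d - 3 := by
    rw [hcard, Nat.cast_sub (by lia)]
    ring
  have hrisk := integratedRisk_jamesStein_add (s := univ.erase i₀) hn (by lia)
    (fun j hj => mem_orthogonal_meanAxis hb (ne_of_mem_erase hj))
    (fun j hj => mem_orthogonal_orthogonal_meanAxis hb (by simpa using hj))
    (posSemidef_compoundSymm (by lia) hρ₀' hρ₁)
    (compoundSymm_quadraticForm_eq_sum_axisVar hρ₀' hρ₁ hb)
  rw [inverseMoment_eq_of_forall_eq (by lia) (w₀ := (1 - ρ).toNNReal + (n : ℝ≥0)⁻¹)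
    (by positivity) fun j hj => by simp [axisVar, ne_of_mem_erase hj],
    ← ENNReal.ofReal_mul (sq_nonneg _), hcard', NNReal.coe_add, Real.coe_toNNReal _ hρ₁',
    NNReal.coe_inv, NNReal.coe_natCast] at hrisk
  simp_rw [← estHB_eq_jamesStein (show d ≠ 0 by lia)] at hrisk
  have hd₃ : 0 < (d : ℝ) - 3 := by linarith
  convert! ne_top_and_toReal_eq_of_add_ofReal_eq (by positivity) (by positivity) hrisk using 3
  field_simp
  ring

theorem integratedRisk_estPHB (hn : n ≠ 0) (hd : 3 ≤ d) (hρ₀ : -1 / ((d : ℝ) - 1) ≤ ρ)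
    (hρ₁ : ρ ≤ 1) :
    integratedRisk (n := n) (d := d) estPHB (multivariateGaussian 0 (compoundSymm d ρ)) ≠ ⊤ ∧
      IntervalIntegrable (fun u : ℝ => u ^ (((d : ℝ) - 2) / 2 - 1) / √(xi n d ρ u)) volume 0 1 ∧
      (integratedRisk (n := n) (d := d) estPHB
        (multivariateGaussian 0 (compoundSymm d ρ))).toReal =
        (d : ℝ) / n - ((d : ℝ) - 2) ^ 2 / (2 * n) *
          ∫ u in (0 : ℝ)..1, u ^ (((d : ℝ) - 2) / 2 - 1) / √(xi n d ρ u) := by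
  let i₀ : Fin d := ⟨0, by lia⟩
  obtain ⟨b, hb⟩ := exists_orthonormalBasis_eq_meanAxis i₀
  have hρ₀' := one_add_mul_nonneg_of_neg_one_div_le (by lia) hρ₀
  have hcard : #(univ : Finset (Fin d)) = d := by simp
  have hrisk := integratedRisk_jamesStein_add (V := ⊤) (s := univ) hn (by lia) (by simp) (by simp)
    (posSemidef_compoundSymm (by lia) hρ₀' hρ₁)
    (compoundSymm_quadraticForm_eq_sum_axisVar hρ₀' hρ₁ hb)
  have hint := intervalIntegrable_rpow_div_sqrt_prod univ (axisVar i₀ ρ) hd n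
  rw [inverseMoment_add_inv univ (axisVar i₀ ρ) (by lia) (Nat.cast_ne_zero.2 hn),
    ← ENNReal.ofReal_mul (sq_nonneg _), hcard] at hrisk
  simp_rw [NNReal.coe_natCast, prod_one_add_axisVar n hρ₀' hρ₁] at hrisk hint
  simp_rw [← estPHB_eq_jamesStein] at hrisk
  have hnonneg : 0 ≤ ∫ u in (0 : ℝ)..1, u ^ (((d : ℝ) - 2) / 2 - 1) / √(xi n d ρ u) :=
    intervalIntegral.integral_nonneg zero_le_one fun u hu =>
      div_nonneg (Real.rpow_nonneg hu.1 _) (Real.sqrt_nonneg _)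
  obtain ⟨hfinite, hvalue⟩ :=
    ne_top_and_toReal_eq_of_add_ofReal_eq (by positivity) (by positivity) hrisk
  refine ⟨hfinite, hint, hvalue.trans ?_⟩
  field_simp

end IntegratedRisk

end NormalMeans

theorem proposition1_general (n d : ℕ) (hn : 1 ≤ n) (hd : 4 ≤ d) (ρ : ℝ)
    (hρ₀ : -1 / ((d : ℝ) - 1) ≤ ρ) (hρ₁ : ρ ≤ 1) :
    (NormalMeans.integratedRisk (n := n) (d := d) NormalMeans.estHB
        (multivariateGaussian 0 (NormalMeans.compoundSymm d ρ)) ≠ ⊤ ∧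
      (NormalMeans.integratedRisk (n := n) (d := d) NormalMeans.estHB
        (multivariateGaussian 0 (NormalMeans.compoundSymm d ρ))).toReal =
        (d : ℝ) / n - ((d : ℝ) - 3) / n * (1 / (1 + (n : ℝ) * (1 - ρ)))) ∧
    (NormalMeans.integratedRisk (n := n) (d := d) NormalMeans.estPHB
        (multivariateGaussian 0 (NormalMeans.compoundSymm d ρ)) ≠ ⊤ ∧
      IntervalIntegrable
        (fun u : ℝ => u ^ (((d : ℝ) - 2) / 2 - 1) / Real.sqrt (NormalMeans.xi n d ρ u))
        volume 0 1 ∧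
      (NormalMeans.integratedRisk (n := n) (d := d) NormalMeans.estPHB
        (multivariateGaussian 0 (NormalMeans.compoundSymm d ρ))).toReal =
        (d : ℝ) / n - ((d : ℝ) - 2) ^ 2 / (2 * n) *
          ∫ u in (0 : ℝ)..1,
            u ^ (((d : ℝ) - 2) / 2 - 1) / Real.sqrt (NormalMeans.xi n d ρ u)) :=
  ⟨NormalMeans.integratedRisk_estHB (by lia) hd hρ₀ hρ₁,
    NormalMeans.integratedRisk_estPHB (by lia) (by lia) hρ₀ hρ₁⟩

theorem proposition1 (n d : ℕ) (hn : 1 ≤ n) (hd : 5 ≤ d) (ρ : ℝ)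
    (hρ₀ : -1 / ((d : ℝ) - 1) < ρ) (hρ₁ : ρ < 1) :
    (NormalMeans.integratedRisk (n := n) (d := d) NormalMeans.estHB
        (multivariateGaussian 0 (NormalMeans.compoundSymm d ρ)) ≠ ⊤ ∧
      (NormalMeans.integratedRisk (n := n) (d := d) NormalMeans.estHB
        (multivariateGaussian 0 (NormalMeans.compoundSymm d ρ))).toReal =
        (d : ℝ) / n - ((d : ℝ) - 3) / n * (1 / (1 + (n : ℝ) * (1 - ρ)))) ∧
    (NormalMeans.integratedRisk (n := n) (d := d) NormalMeans.estPHB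
        (multivariateGaussian 0 (NormalMeans.compoundSymm d ρ)) ≠ ⊤ ∧
      IntervalIntegrable
        (fun u : ℝ => u ^ (((d : ℝ) - 2) / 2 - 1) / Real.sqrt (NormalMeans.xi n d ρ u))
        volume 0 1 ∧
      (NormalMeans.integratedRisk (n := n) (d := d) NormalMeans.estPHB
        (multivariateGaussian 0 (NormalMeans.compoundSymm d ρ))).toReal =
        (d : ℝ) / n - ((d : ℝ) - 2) ^ 2 / (2 * n) *
          ∫ u in (0 : ℝ)..1,
            u ^ (((d : ℝ) - 2) / 2 - 1) / Real.sqrt (NormalMeans.xi n d ρ u)) :=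
  proposition1_general n d hn (by lia) ρ hρ₀.le hρ₁.le
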